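/- Let $\mathbb F$ be an algebraically closed field and let $q\in\mathbb F$ be nonzero and not a root of unity. Let $\triangle_q$ (the universal Askey--Wilson algebra) be the unital associative $\mathbb F$-algebra with generators $A,B,C$ and the relations stating that each of $$A+\frac{qBC-q^{-1}CB}{q^2-q^{-2}},\qquad B+\frac{qCA-q^{-1}AC}{q^2-q^{-2}},\qquad C+\frac{qAB-q^{-1}BA}{q^2-q^{-2}}$$ commutes with $A,B,C$. Let $\mathfrak H_q$ (the universal double affine Hecke algebra of type $(C_1^\vee,C_1)$) be the unital associative $\mathbb F$-algebra with generators $t_0^{\pm1},t_1^{\pm1},t_2^{\pm1},t_3^{\pm1}$ and the relations $t_it_i^{-1}=t_i^{-1}t_i=1$ and $t_i+t_i^{-1}$ is central for $i=0,1,2,3$, and $t_0t_1t_2t_3=q^{-1}$. View each $\mathfrak H_q$-module as a $\triangle_q$-module by pulling back along the $\mathbb F$-algebra homomorphism $\zeta:\triangle_q\to\mathfrak H_q$ given by $$A\mapsto t_1t_0+(t_1t_0)^{-1},\qquad B\mapsto t_3t_0+(t_3t_0)^{-1},\qquad C\mapsto t_2t_0+(t_2t_0)^{-1}.$$ Then for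 every finite-dimensional irreducible $\mathfrak H_q$-module $V$, the $\triangle_q$-module $V$ is completely reducible if and only if $t_0$ is diagonalizable on $V$. -/

import Mathlib

universe u v

/-- An endomorphism is diagonalizable if there is a basis consisting of eigenvectors. -/
def IsDiagonalizable {F : Type u} {V : Type v} [Field F] [AddCommGroup V] [Module F V]
    (f : Module.End F V) : Prop :=
  ∃ (ι : Type v) (b : Module.Basis ι F V), ∀ i, ∃ μ : F, f (b i) = μ • b i

/-- The generators `A, B, C` of the universal Askey--Wilson algebra. -/
inductive AWGen : Type
  | A
  | B
  | C

/-- The element `X + (q Y Z - q⁻¹ Z Y) / (q² - q⁻²)`. -/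
def awElt {F : Type u} {R : Type v} [Field F] [Ring R] [Algebra F R] (q : F) (X Y Z : R) : R :=
  X + (q ^ 2 - q⁻¹ ^ 2)⁻¹ • (q • (Y * Z) - q⁻¹ • (Z * Y))

/-- The defining relations of the universal Askey--Wilson algebra: each of the three elements
commutes with the generators. -/
inductive AWRel {F : Type u} [Field F] (q : F) :
    FreeAlgebra F AWGen → FreeAlgebra F AWGen → Prop
  | alpha (g : AWGen) : AWRel q
      (awElt q (FreeAlgebra.ι F AWGen.A) (FreeAlgebra.ι F AWGen.B) (FreeAlgebra.ι F AWGen.C)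
        * FreeAlgebra.ι F g)
      (FreeAlgebra.ι F g
        * awElt q (FreeAlgebra.ι F AWGen.A) (FreeAlgebra.ι F AWGen.B) (FreeAlgebra.ι F AWGen.C))
  | beta (g : AWGen) : AWRel q
      (awElt q (FreeAlgebra.ι F AWGen.B) (FreeAlgebra.ι F AWGen.C) (FreeAlgebra.ι F AWGen.A)
        * FreeAlgebra.ι F g)
      (FreeAlgebra.ι F g
        * awElt q (FreeAlgebra.ι F AWGen.B) (FreeAlgebra.ι F AWGen.C) (FreeAlgebra.ι F AWGen.A))
  | gamma (g : AWGen) : AWRel q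
      (awElt q (FreeAlgebra.ι F AWGen.C) (FreeAlgebra.ι F AWGen.A) (FreeAlgebra.ι F AWGen.B)
        * FreeAlgebra.ι F g)
      (FreeAlgebra.ι F g
        * awElt q (FreeAlgebra.ι F AWGen.C) (FreeAlgebra.ι F AWGen.A) (FreeAlgebra.ι F AWGen.B))

/-- The universal Askey--Wilson algebra `△_q`. -/
abbrev UniversalAW {F : Type u} [Field F] (q : F) : Type u := RingQuot (AWRel q)

/-- The image of a generator in `△_q`. -/
def UniversalAW.gen {F : Type u} [Field F] (q : F) (g : AWGen) : UniversalAW q :=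
  RingQuot.mkAlgHom F (AWRel q) (FreeAlgebra.ι F g)

/-- The generators `t_i` and `t_i⁻¹` (`i = 0, 1, 2, 3`) of the universal DAHA. -/
inductive DAHAGen : Type
  | t (i : Fin 4)
  | tInv (i : Fin 4)

/-- The defining relations of the universal DAHA of type `(C₁^∨, C₁)`. -/
inductive DAHARel {F : Type u} [Field F] (q : F) :
    FreeAlgebra F DAHAGen → FreeAlgebra F DAHAGen → Prop
  | mul_inv (i : Fin 4) : DAHARel q
      (FreeAlgebra.ι F (DAHAGen.t i) * FreeAlgebra.ι F (DAHAGen.tInv i)) 1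
  | inv_mul (i : Fin 4) : DAHARel q
      (FreeAlgebra.ι F (DAHAGen.tInv i) * FreeAlgebra.ι F (DAHAGen.t i)) 1
  | central (i : Fin 4) (x : FreeAlgebra F DAHAGen) : DAHARel q
      ((FreeAlgebra.ι F (DAHAGen.t i) + FreeAlgebra.ι F (DAHAGen.tInv i)) * x)
      (x * (FreeAlgebra.ι F (DAHAGen.t i) + FreeAlgebra.ι F (DAHAGen.tInv i)))
  | prod : DAHARel q
      (FreeAlgebra.ι F (DAHAGen.t 0) * FreeAlgebra.ι F (DAHAGen.t 1)
        * FreeAlgebra.ι F (DAHAGen.t 2) * FreeAlgebra.ι F (DAHAGen.t 3))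
      (algebraMap F (FreeAlgebra F DAHAGen) q⁻¹)

/-- The universal DAHA `H_q` of type `(C₁^∨, C₁)`. -/
abbrev UniversalDAHA {F : Type u} [Field F] (q : F) : Type u := RingQuot (DAHARel q)

namespace UniversalDAHA

/-- The generator `t_i` of `H_q`. -/
def t {F : Type u} [Field F] (q : F) (i : Fin 4) : UniversalDAHA q :=
  RingQuot.mkAlgHom F (DAHARel q) (FreeAlgebra.ι F (DAHAGen.t i))

/-- The generator `t_i⁻¹` of `H_q`. -/
def tInv {F : Type u} [Field F] (q : F) (i : Fin 4) : UniversalDAHA q :=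
  RingQuot.mkAlgHom F (DAHARel q) (FreeAlgebra.ι F (DAHAGen.tInv i))

theorem t_mul_tInv {F : Type u} [Field F] (q : F) (i : Fin 4) : t q i * tInv q i = 1 := by
  simpa [t, tInv] using RingQuot.mkAlgHom_rel F (DAHARel.mul_inv (q := q) i)

theorem tInv_mul_t {F : Type u} [Field F] (q : F) (i : Fin 4) : tInv q i * t q i = 1 := by
  simpa [t, tInv] using RingQuot.mkAlgHom_rel F (DAHARel.inv_mul (q := q) i)

theorem central {F : Type u} [Field F] (q : F) (i : Fin 4) (x : UniversalDAHA q) :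
    (t q i + tInv q i) * x = x * (t q i + tInv q i) := by
  obtain ⟨y, rfl⟩ := RingQuot.mkAlgHom_surjective F (DAHARel q) x
  simpa only [t, tInv, map_mul, map_add] using
    RingQuot.mkAlgHom_rel F (DAHARel.central (q := q) i y)

theorem prod_t {F : Type u} [Field F] (q : F) :
    t q 0 * t q 1 * t q 2 * t q 3 = algebraMap F (UniversalDAHA q) q⁻¹ := by
  have h := RingQuot.mkAlgHom_rel F (DAHARel.prod (q := q))
  rw [AlgHom.commutes] at h
  simpa only [t, map_mul] using h

end UniversalDAHA

/-! Verification that the images of `A, B, C` in `H_q` satisfy the relations of `△_q`. -/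

theorem AW.commute_aux {K R : Type*} [CommRing K] [Ring R] [Algebra K R] (c₀ c₁ : K)
    {t₀ t₁ s₀ s₁ : R} (a₀ : t₀ * s₀ = 1) (b₀ : s₀ * t₀ = 1)
    (e₀ : s₀ = c₀ • 1 - t₀) (e₁ : s₁ = c₁ • 1 - t₁) :
    t₀ * (t₁ * t₀ + s₀ * s₁) = (t₁ * t₀ + s₀ * s₁) * t₀ := by
  have h1 : t₀ * t₀ = c₀ • t₀ - 1 := by
    have := a₀
    rw [e₀, mul_sub, mul_smul_comm, mul_one] at this
    rw [← this]; abel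
  have h2 : t₀ * (s₀ * s₁) = s₁ := by rw [← mul_assoc, a₀, one_mul]
  have h3 : s₀ * s₁ * t₀ = c₁ • 1 - c₀ • (t₁ * t₀) + t₀ * (t₁ * t₀) := by
    rw [e₁, mul_sub, mul_smul_comm, mul_one, sub_mul, smul_mul_assoc, b₀, mul_assoc, e₀,
      sub_mul, smul_mul_assoc, one_mul]
    abel
  rw [mul_add, add_mul, h2, h3, mul_assoc t₁, h1, mul_sub, mul_smul_comm, mul_one, e₁]
  abel

theorem AW.relation_aux {K R : Type*} [CommRing K] [Ring R] [Algebra K R] (q p c₀ c₁ c₂ c₃ : K)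
    (hqp : q * p = 1) {t₀ t₁ t₂ t₃ s₀ s₁ s₂ s₃ : R}
    (a₀ : t₀ * s₀ = 1) (a₂ : t₂ * s₂ = 1) (a₃ : t₃ * s₃ = 1)
    (b₀ : s₀ * t₀ = 1) (b₁ : s₁ * t₁ = 1) (b₂ : s₂ * t₂ = 1)
    (e₀ : s₀ = c₀ • 1 - t₀) (e₁ : s₁ = c₁ • 1 - t₁)
    (e₂ : s₂ = c₂ • 1 - t₂) (e₃ : s₃ = c₃ • 1 - t₃)
    (h : t₀ * t₁ * t₂ * t₃ = p • 1) :
    (q ^ 2 - p ^ 2) • (t₁ * t₀ + s₀ * s₁)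
      + (q • ((t₃ * t₀ + s₀ * s₃) * (t₂ * t₀ + s₀ * s₂))
        - p • ((t₂ * t₀ + s₀ * s₂) * (t₃ * t₀ + s₀ * s₃)))
      = (q - p) • ((c₃ * c₂) • (1 : R) + c₁ • (q • s₀ + p • t₀)) := by
  have w1 : t₁ * t₂ = p • (s₀ * s₃) := by
    calc t₁ * t₂ = s₀ * (t₀ * t₁ * t₂ * t₃) * s₃ := by
          simp only [mul_assoc, a₃, mul_one]; rw [← mul_assoc s₀, b₀, one_mul]
      _ = _ := by rw [h]; simp
  have w2 : s₂ * s₁ = q • (t₃ * t₀) := by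
    have h' : t₁ * (t₂ * (t₃ * t₀)) = p • 1 := by
      calc t₁ * (t₂ * (t₃ * t₀)) = s₀ * (t₀ * t₁ * t₂ * t₃) * t₀ := by
            simp only [mul_assoc]; rw [← mul_assoc s₀, b₀, one_mul]
        _ = _ := by rw [h]; simp [b₀]
    calc s₂ * s₁ = (q * p) • (s₂ * s₁) := by rw [hqp, one_smul]
      _ = q • (s₂ * (s₁ * (p • 1))) := by simp [mul_smul]
      _ = _ := by
        rw [← h', ← mul_assoc s₁, b₁, one_mul, ← mul_assoc s₂, b₂, one_mul]
  have hBt := AW.commute_aux c₀ c₃ a₀ b₀ e₀ e₃ (t₁ := t₃) (s₁ := s₃)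
  set B := t₃ * t₀ + s₀ * s₃ with hB
  have hBs : B * s₀ = s₀ * B := by
    rw [e₀, mul_sub, sub_mul, hBt]; simp
  have hB' : B = q • (t₁ * t₂) + p • (s₂ * s₁) := by
    rw [w1, w2, smul_smul, smul_smul, hqp, mul_comm p, hqp, one_smul, one_smul, add_comm]
  have x1 : t₂ * B = q • (t₂ * t₁ * t₂) + p • s₁ := by
    rw [hB', mul_add, mul_smul_comm, mul_smul_comm, ← mul_assoc, ← mul_assoc, a₂, one_mul]
  have x2 : s₂ * B = c₂ • B - t₂ * B := by rw [e₂, sub_mul, smul_mul_assoc, one_mul]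
  have x3 : B * s₂ = q • t₁ + p • (s₂ * s₁ * s₂) := by
    rw [hB', add_mul, smul_mul_assoc, smul_mul_assoc, mul_assoc t₁, a₂, mul_one]
  have x4 : B * t₂ = c₂ • B - B * s₂ := by rw [e₂, mul_sub, mul_smul_comm, mul_one]; abel
  have hCB : (t₂ * t₀ + s₀ * s₂) * B = (q • (t₂ * t₁ * t₂) + p • s₁) * t₀
      + s₀ * (c₂ • B - (q • (t₂ * t₁ * t₂) + p • s₁)) := by
    rw [add_mul, mul_assoc, hBt, ← mul_assoc, x1, mul_assoc s₀, x2, x1]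
  have hBC : B * (t₂ * t₀ + s₀ * s₂) = (c₂ • B - (q • t₁ + p • (s₂ * s₁ * s₂))) * t₀
      + s₀ * (q • t₁ + p • (s₂ * s₁ * s₂)) := by
    rw [mul_add, ← mul_assoc, x4, ← mul_assoc, hBs, mul_assoc, x3]
  have sq2 : t₂ * t₂ = c₂ • t₂ - 1 := by
    have := a₂
    rw [e₂, mul_sub, mul_smul_comm, mul_one] at this
    rw [← this]; abel
  have hpq : p * q = 1 := by rw [mul_comm, hqp]
  have hZ : s₂ * s₁ * s₂ = c₂ • ((1 - q ^ 2) • (t₁ * t₂) + q • B) - c₁ • 1 - t₂ * t₁ * t₂ := by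
    have y : q • B = q ^ 2 • (t₁ * t₂) + s₂ * s₁ := by
      rw [hB', smul_add, smul_smul, smul_smul, hqp, one_smul, sq]
    rw [y, e₂, e₁]
    simp only [sub_mul, mul_sub, smul_mul_assoc, mul_smul_comm, one_mul, mul_one, sq2, mul_assoc]
    module
  have hBt0 : B * t₀ = q • (t₁ * t₂ * t₀) + p • (s₂ * s₁ * t₀) := by
    rw [hB', add_mul, smul_mul_assoc, smul_mul_assoc]
  have hsB : s₀ * B = q • (s₀ * (t₁ * t₂)) + p • (s₀ * (s₂ * s₁)) := by
    rw [hB', mul_add, mul_smul_comm, mul_smul_comm]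
  have last : p • (s₀ * (s₂ * s₁)) + q • (t₁ * t₂ * t₀) = c₃ • 1 := by
    rw [w1, w2, mul_smul_comm, smul_mul_assoc, smul_smul, smul_smul, hqp, hpq, e₃]
    simp only [sub_mul, mul_sub, smul_mul_assoc, mul_smul_comm, mul_one, mul_assoc, b₀]
    module
  have m1 : s₁ * t₀ = c₁ • t₀ - t₁ * t₀ := by rw [e₁, sub_mul, smul_mul_assoc, one_mul]
  have m2 : s₀ * s₁ = c₁ • s₀ - s₀ * t₁ := by rw [e₁, mul_sub, mul_smul_comm, mul_one]
  rw [hBC, hCB, hZ]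
  simp only [add_mul, sub_mul, mul_add, mul_sub, smul_mul_assoc, mul_smul_comm, one_mul, mul_one,
    m1, m2, hsB]
  have last2 : q • (t₁ * t₂ * t₀) = c₃ • 1 - p • (s₀ * (s₂ * s₁)) := by rw [← last]; abel
  generalize t₂ * t₁ * t₂ * t₀ = M at *
  generalize s₀ * (t₂ * t₁ * t₂) = M' at *
  generalize t₁ * t₂ * t₀ = W at *
  generalize s₀ * (t₁ * t₂) = W' at *
  generalize s₀ * (s₂ * s₁) = U at *
  generalize s₀ * t₁ = y at *
  generalize t₁ * t₀ = y' at *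
  generalize B * t₀ = z at *
  clear * - last2 hqp
  linear_combination (norm := module) (c₂ * (q - p)) • last2
    + hqp • ((c₂ * q ^ 2) • W - (c₂ * q) • z + (-c₂ * q ^ 2) • W'
      + (c₂ * q) • (q • W' + p • U))

theorem AW.commute_t0 {R : Type v} [Ring R] {t₀ t₁ s₀ s₁ : R}
    (a₀ : t₀ * s₀ = 1) (b₀ : s₀ * t₀ = 1)
    (z₀ : ∀ x, (t₀ + s₀) * x = x * (t₀ + s₀)) (z₁ : ∀ x, (t₁ + s₁) * x = x * (t₁ + s₁)) :
    t₀ * (t₁ * t₀ + s₀ * s₁) = (t₁ * t₀ + s₀ * s₁) * t₀ := by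
  let _ : Algebra (Subring.center R) R :=
    (Subring.center R).subtype.toAlgebra' fun c x => (Subring.mem_center_iff.1 c.2 x).symm
  have hc : ∀ y : R, (∀ x, y * x = x * y) → y ∈ Subring.center R :=
    fun y hy => Subring.mem_center_iff.2 fun x => (hy x).symm
  refine AW.commute_aux (K := Subring.center R) ⟨_, hc _ z₀⟩ ⟨_, hc _ z₁⟩ a₀ b₀ ?_ ?_ <;>
  · rw [Algebra.smul_def, mul_one]
    exact (add_sub_cancel_left _ _).symm

theorem AW.commute_awElt {F : Type u} {R : Type v} [Field F] [Ring R] [Algebra F R] (q : F)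
    (hq0 : q ≠ 0) (hq : ∀ n : ℕ, 0 < n → q ^ n ≠ 1) {t₀ t₁ t₂ t₃ s₀ s₁ s₂ s₃ : R}
    (a₀ : t₀ * s₀ = 1) (a₂ : t₂ * s₂ = 1) (a₃ : t₃ * s₃ = 1)
    (b₀ : s₀ * t₀ = 1) (b₁ : s₁ * t₁ = 1) (b₂ : s₂ * t₂ = 1)
    (z₀ : ∀ x, (t₀ + s₀) * x = x * (t₀ + s₀)) (z₁ : ∀ x, (t₁ + s₁) * x = x * (t₁ + s₁))
    (z₂ : ∀ x, (t₂ + s₂) * x = x * (t₂ + s₂)) (z₃ : ∀ x, (t₃ + s₃) * x = x * (t₃ + s₃))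
    (h : t₀ * t₁ * t₂ * t₃ = algebraMap F R q⁻¹) (x : R) (hx : t₀ * x = x * t₀) :
    awElt q (t₁ * t₀ + s₀ * s₁) (t₃ * t₀ + s₀ * s₃) (t₂ * t₀ + s₀ * s₂) * x
      = x * awElt q (t₁ * t₀ + s₀ * s₁) (t₃ * t₀ + s₀ * s₃) (t₂ * t₀ + s₀ * s₂) := by
  let _ : Algebra (Subring.center R) R :=
    (Subring.center R).subtype.toAlgebra' fun c x => (Subring.mem_center_iff.1 c.2 x).symm
  have hc : ∀ y : R, (∀ x, y * x = x * y) → y ∈ Subring.center R :=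
    fun y hy => Subring.mem_center_iff.2 fun x => (hy x).symm
  have hs : ∀ (y : Subring.center R) (r : R), y • r = (y : R) * r := fun y r =>
    Algebra.smul_def y r
  have key := AW.relation_aux (K := Subring.center R) (R := R)
    ⟨_, hc _ (Algebra.commutes q)⟩ ⟨_, hc _ (Algebra.commutes q⁻¹)⟩
    ⟨_, hc _ z₀⟩ ⟨_, hc _ z₁⟩ ⟨_, hc _ z₂⟩ ⟨_, hc _ z₃⟩
    (by ext; simp [← map_mul, hq0]) a₀ a₂ a₃ b₀ b₁ b₂
    (by rw [hs]; simp) (by rw [hs]; simp) (by rw [hs]; simp) (by rw [hs]; simp)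
    (by rw [hs]; simpa using h)
  simp only [hs] at key
  push_cast at key
  simp only [mul_one, ← map_pow, ← map_sub, ← Algebra.smul_def] at key
  have hd : q ^ 2 - q⁻¹ ^ 2 ≠ 0 := by
    intro h0
    apply hq 4 (by norm_num)
    field_simp at h0
    linear_combination h0
  have hE : awElt q (t₁ * t₀ + s₀ * s₁) (t₃ * t₀ + s₀ * s₃) (t₂ * t₀ + s₀ * s₂)
      = (q ^ 2 - q⁻¹ ^ 2)⁻¹ • (q - q⁻¹) • ((t₃ + s₃) * (t₂ + s₂)
        + (t₁ + s₁) * (q • s₀ + q⁻¹ • t₀)) := by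
    rw [← key, smul_add, smul_smul, inv_mul_cancel₀ hd, one_smul]
    rfl
  have hx' : Commute s₀ x := by
    show s₀ * x = x * s₀
    calc s₀ * x = s₀ * (x * t₀) * s₀ := by rw [mul_assoc, mul_assoc, a₀, mul_one]
      _ = x * s₀ := by rw [← hx, ← mul_assoc, b₀, one_mul]
  have hx0 : Commute t₀ x := hx
  have k1 : Commute (t₁ + s₁) x := z₁ x
  have k2 : Commute (t₂ + s₂) x := z₂ x
  have k3 : Commute (t₃ + s₃) x := z₃ x
  rw [hE]
  exact (((k3.mul_left k2).add_left
    (k1.mul_left ((hx'.smul_left q).add_left (hx0.smul_left q⁻¹)))).smul_left _).smul_left _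

namespace UniversalDAHA

/-- The images of the generators: `A ↦ t₁t₀ + (t₁t₀)⁻¹`, `B ↦ t₃t₀ + (t₃t₀)⁻¹`,
`C ↦ t₂t₀ + (t₂t₀)⁻¹`, where `(t_i t₀)⁻¹ = t₀⁻¹ t_i⁻¹`. -/
def zetaGen {F : Type u} [Field F] (q : F) : AWGen → UniversalDAHA q
  | AWGen.A => t q 1 * t q 0 + tInv q 0 * tInv q 1
  | AWGen.B => t q 3 * t q 0 + tInv q 0 * tInv q 3
  | AWGen.C => t q 2 * t q 0 + tInv q 0 * tInv q 2

theorem t_zero_commute_zetaGen {F : Type u} [Field F] (q : F) (g : AWGen) :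
    t q 0 * zetaGen q g = zetaGen q g * t q 0 := by
  cases g <;>
  exact AW.commute_t0 (t_mul_tInv q 0) (tInv_mul_t q 0) (central q 0) (central q _)

theorem zetaGen_conj {F : Type u} [Field F] (q : F) (i : Fin 4)
    (h : t q 0 * (t q i * t q 0 + tInv q 0 * tInv q i)
      = (t q i * t q 0 + tInv q 0 * tInv q i) * t q 0) :
    (tInv q 0 * t q i * t q 0) * t q 0 + tInv q 0 * (tInv q 0 * tInv q i * t q 0)
      = t q i * t q 0 + tInv q 0 * tInv q i := by
  calc _ = tInv q 0 * ((t q i * t q 0 + tInv q 0 * tInv q i) * t q 0) := by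
        simp only [mul_add, add_mul, mul_assoc]
    _ = _ := by rw [← h, ← mul_assoc, tInv_mul_t, one_mul]

theorem conj_central {F : Type u} [Field F] (q : F) (i : Fin 4) (x : UniversalDAHA q) :
    (tInv q 0 * t q i * t q 0 + tInv q 0 * tInv q i * t q 0) * x
      = x * (tInv q 0 * t q i * t q 0 + tInv q 0 * tInv q i * t q 0) := by
  have h : tInv q 0 * t q i * t q 0 + tInv q 0 * tInv q i * t q 0 = t q i + tInv q i := by
    rw [← add_mul, ← mul_add, ← central, mul_assoc, tInv_mul_t, mul_one]
  rw [h, central]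

theorem conj_mul {F : Type u} [Field F] (q : F) (x y : UniversalDAHA q) (h : x * y = 1) :
    (tInv q 0 * x * t q 0) * (tInv q 0 * y * t q 0) = 1 := by
  calc _ = tInv q 0 * (x * ((t q 0 * tInv q 0) * y)) * t q 0 := by simp only [mul_assoc]
    _ = 1 := by rw [t_mul_tInv, one_mul, h, mul_one, tInv_mul_t]

theorem rel_alpha {F : Type u} [Field F] (q : F) (hq0 : q ≠ 0)
    (hq : ∀ n : ℕ, 0 < n → q ^ n ≠ 1) (g : AWGen) :
    awElt q (zetaGen q AWGen.A) (zetaGen q AWGen.B) (zetaGen q AWGen.C) * zetaGen q g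
      = zetaGen q g * awElt q (zetaGen q AWGen.A) (zetaGen q AWGen.B) (zetaGen q AWGen.C) :=
  AW.commute_awElt q hq0 hq (t_mul_tInv q 0) (t_mul_tInv q 2) (t_mul_tInv q 3)
    (tInv_mul_t q 0) (tInv_mul_t q 1) (tInv_mul_t q 2)
    (central q 0) (central q 1) (central q 2) (central q 3) (prod_t q) _
    (t_zero_commute_zetaGen q g)

/-- Cyclic rotation of the last defining relation. -/
theorem prod_t_rot {F : Type u} [Field F] (q : F) :
    t q 3 * t q 0 * t q 1 * t q 2 = algebraMap F (UniversalDAHA q) q⁻¹ := by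
  calc _ = t q 3 * (t q 0 * t q 1 * t q 2 * t q 3) * tInv q 3 := by
        simp only [mul_assoc, t_mul_tInv, mul_one]
    _ = _ := by
        rw [prod_t, ← Algebra.commutes, mul_assoc, t_mul_tInv, mul_one]

theorem prod_t_rot_rot {F : Type u} [Field F] (q : F) :
    t q 2 * t q 3 * t q 0 * t q 1 = algebraMap F (UniversalDAHA q) q⁻¹ := by
  calc _ = t q 2 * (t q 3 * t q 0 * t q 1 * t q 2) * tInv q 2 := by
        simp only [mul_assoc, t_mul_tInv, mul_one]
    _ = _ := by
        rw [prod_t_rot, ← Algebra.commutes, mul_assoc, t_mul_tInv, mul_one]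

theorem rel_beta {F : Type u} [Field F] (q : F) (hq0 : q ≠ 0)
    (hq : ∀ n : ℕ, 0 < n → q ^ n ≠ 1) (g : AWGen) :
    awElt q (zetaGen q AWGen.B) (zetaGen q AWGen.C) (zetaGen q AWGen.A) * zetaGen q g
      = zetaGen q g * awElt q (zetaGen q AWGen.B) (zetaGen q AWGen.C) (zetaGen q AWGen.A) := by
  have h := AW.commute_awElt q hq0 hq (t₁ := tInv q 0 * t q 3 * t q 0)
    (s₁ := tInv q 0 * tInv q 3 * t q 0)
    (t_mul_tInv q 0) (t_mul_tInv q 1) (t_mul_tInv q 2)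
    (tInv_mul_t q 0) (conj_mul q _ _ (tInv_mul_t q 3)) (tInv_mul_t q 1)
    (central q 0) (conj_central q 3) (central q 1) (central q 2)
    (by
      rw [← prod_t_rot q]
      simp only [← mul_assoc]
      rw [t_mul_tInv, one_mul]) _ (t_zero_commute_zetaGen q g)
  rw [zetaGen_conj q 3 (t_zero_commute_zetaGen q AWGen.B)] at h
  exact h

theorem rel_gamma {F : Type u} [Field F] (q : F) (hq0 : q ≠ 0)
    (hq : ∀ n : ℕ, 0 < n → q ^ n ≠ 1) (g : AWGen) :
    awElt q (zetaGen q AWGen.C) (zetaGen q AWGen.A) (zetaGen q AWGen.B) * zetaGen q g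
      = zetaGen q g * awElt q (zetaGen q AWGen.C) (zetaGen q AWGen.A) (zetaGen q AWGen.B) := by
  have h := AW.commute_awElt q hq0 hq (t₁ := tInv q 0 * t q 2 * t q 0)
    (s₁ := tInv q 0 * tInv q 2 * t q 0) (t₂ := tInv q 0 * t q 3 * t q 0)
    (s₂ := tInv q 0 * tInv q 3 * t q 0)
    (t_mul_tInv q 0) (conj_mul q _ _ (t_mul_tInv q 3)) (t_mul_tInv q 1)
    (tInv_mul_t q 0) (conj_mul q _ _ (tInv_mul_t q 2)) (conj_mul q _ _ (tInv_mul_t q 3))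
    (central q 0) (conj_central q 2) (conj_central q 3) (central q 1)
    (by
      rw [← prod_t_rot_rot q]
      simp only [← mul_assoc]
      rw [t_mul_tInv, one_mul, mul_assoc (t q 2) (t q 0), t_mul_tInv, mul_one]) _
    (t_zero_commute_zetaGen q g)
  rw [zetaGen_conj q 2 (t_zero_commute_zetaGen q AWGen.C),
    zetaGen_conj q 3 (t_zero_commute_zetaGen q AWGen.B)] at h
  exact h

/-- The algebra homomorphism `ζ : △_q → H_q`. -/
def zeta {F : Type u} [Field F] (q : F) (hq0 : q ≠ 0) (hq : ∀ n : ℕ, 0 < n → q ^ n ≠ 1) :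
    UniversalAW q →ₐ[F] UniversalDAHA q :=
  RingQuot.liftAlgHom F ⟨FreeAlgebra.lift F (zetaGen q), by
    intro x y hxy
    cases hxy with
    | alpha g => simpa [awElt] using rel_alpha q hq0 hq g
    | beta g => simpa [awElt] using rel_beta q hq0 hq g
    | gamma g => simpa [awElt] using rel_gamma q hq0 hq g⟩

theorem zeta_gen {F : Type u} [Field F] (q : F) (hq0 : q ≠ 0)
    (hq : ∀ n : ℕ, 0 < n → q ^ n ≠ 1) (g : AWGen) :
    zeta q hq0 hq (UniversalAW.gen q g) = zetaGen q g := by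
  simp [zeta, UniversalAW.gen]

/-- The `△_q`-module structure on an `H_q`-module `V` obtained by pulling back via `ζ`. -/
abbrev pullbackModule {F : Type u} [Field F] (q : F) (hq0 : q ≠ 0)
    (hq : ∀ n : ℕ, 0 < n → q ^ n ≠ 1) (V : Type v) [AddCommGroup V]
    [Module (UniversalDAHA q) V] : Module (UniversalAW q) V :=
  Module.compHom V (zeta q hq0 hq).toRingHom

end UniversalDAHA

/-!
By Schur's lemma the central elements `t_i + t_i⁻¹` act on `V` as scalars `c_i`; write
`c_0 = k + k'` with `k k' = 1`, so that `(t_0 - k)(t_0 - k') = 0` on `V`. The image of `△_q`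
commutes with `t_0`.

If `k ≠ k'`, then `t_0` is diagonalizable and its eigenspaces are `△_q`-submodules. Let `W` be a
nonzero `△_q`-submodule of the `k`-eigenspace. The relations of `H_q` show that the sum of the
subspaces `t_i W` is an `H_q`-submodule, hence all of `V`, and that `t_0 - k'` maps it into `W`.
As `t_0 - k'` acts on the `k`-eigenspace as `k - k' ≠ 0`, this eigenspace is `W`. So both
eigenspaces are zero or irreducible, and `V` is completely reducible.

If `k = k'`, then `t_0 - k` is nilpotent, so `t_0` is diagonalizable exactly when it acts as `k`.
In that case `A, B, C` act as scalars. Conversely, a determinant computation shows that some `c_i`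
with `i ≠ 0` is nonzero, as otherwise `q` would be a root of unity. The explicit formula for one of
the central elements of `△_q` then exhibits `t_0` in the image of `△_q`; there `t_0 - k` is central
and nilpotent, and so it vanishes on every completely reducible module.
-/

section Generalities

open Polynomial in
theorem exists_mul_eq_one_and_eq_add {F : Type*} [Field F] [IsAlgClosed F] (x : F) :
    ∃ k k' : F, k * k' = 1 ∧ x = k + k' := by
  have hdeg : (X ^ 2 - C x * X + 1 : F[X]).degree = 2 := by compute_degree!
  obtain ⟨k, hk⟩ := IsAlgClosed.exists_root _ (hdeg.trans_ne two_ne_zero)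
  replace hk : k ^ 2 - x * k + 1 = 0 := by simpa using hk
  exact ⟨k, x - k, by linear_combination -hk, by ring⟩

theorem smul_eq_zero_of_isNilpotent_of_commute {A M : Type*} [Ring A] [AddCommGroup M] [Module A M]
    [IsSemisimpleModule A M] {a : A} (ha : IsNilpotent a) (hcomm : ∀ b, Commute b a) (m : M) :
    a • m = 0 := by
  refine Module.mem_annihilator.1 (IsSemisimpleModule.jacobson_le_annihilator A M ?_) m
  rw [← Ideal.jacobson_bot, Ideal.mem_jacobson_iff]
  intro y
  have hunit : IsUnit (y * a + 1) := ((hcomm y).isNilpotent_mul_left ha).isUnit_add_one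
  obtain ⟨u, hu⟩ := hunit
  exact ⟨↑u⁻¹, by rw [mul_assoc, ← mul_add_one, ← hu, u.inv_mul, sub_self]; exact zero_mem _⟩

theorem isSemisimpleModule_of_forall_le {A M : Type*} [Ring A] [AddCommGroup M] [Module A M]
    {P : Submodule A M} (h : ∀ W ≤ P, W = ⊥ ∨ W = P) : IsSemisimpleModule A P := by
  rcases eq_or_ne P ⊥ with rfl | hP
  · exact (isSemisimpleModule_iff _ _).2 Subsingleton.instComplementedLattice
  · have : IsSimpleModule A P := isSimpleModule_iff_isAtom.2
      ⟨hP, fun W hW => (h W hW.le).resolve_right hW.ne⟩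
    infer_instance

theorem isSemisimpleModule_of_sup_eq_top {A M : Type*} [Ring A] [AddCommGroup M] [Module A M]
    {P Q : Submodule A M} [hP : IsSemisimpleModule A P] [hQ : IsSemisimpleModule A Q]
    (h : P ⊔ Q = ⊤) : IsSemisimpleModule A M := by
  have htop : IsSemisimpleModule A ↥(⊤ : Submodule A M) := h ▸ hP.sup hQ
  exact .congr Submodule.topEquiv.symm

theorem range_eq_adjoin_mkAlgHom_ι {F X B : Type*} [CommSemiring F] [Semiring B] [Algebra F B]
    {r : FreeAlgebra F X → FreeAlgebra F X → Prop} (f : RingQuot r →ₐ[F] B) :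
    f.range = Algebra.adjoin F
      (Set.range fun x => f (RingQuot.mkAlgHom F r (FreeAlgebra.ι F x))) := by
  have hmk : (⊤ : Subalgebra F (RingQuot r)) = (RingQuot.mkAlgHom F r).range :=
    ((AlgHom.range_eq_top _).2 (RingQuot.mkAlgHom_surjective F r)).symm
  rw [← Algebra.map_top, hmk, ← AlgHom.range_comp, ← Algebra.map_top,
    ← FreeAlgebra.adjoin_range_ι, AlgHom.map_adjoin, ← Set.range_comp]
  rfl

theorem exists_smul_eq_of_forall_commute {F A V : Type*} [Field F] [IsAlgClosed F] [Ring A]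
    [Algebra F A] [AddCommGroup V] [Module F V] [Module A V] [IsScalarTower F A V]
    [FiniteDimensional F V] [IsSimpleModule A V] {z : A} (hz : ∀ a, Commute z a) :
    ∃ c : F, ∀ v : V, z • v = c • v := by
  let action : Module.End A V :=
    { DistribSMul.toAddMonoidHom V z with
      map_smul' := fun a v => by
        change z • a • v = a • z • v
        rw [smul_smul, (hz a).eq, mul_smul] }
  obtain ⟨c, hc⟩ := (IsSimpleModule.algebraMap_end_bijective_of_isAlgClosed F).2 action
  exact ⟨c, fun v => (LinearMap.congr_fun hc v).symm⟩

theorem exists_restrictScalars_eq {F V : Type*} [CommRing F] [AddCommGroup V] [Module F V]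
    {s : Set (Module.End F V)} {P : Submodule F V} (hP : ∀ f ∈ s, P ∈ f.invtSubmodule) :
    ∃ Q : Submodule (Algebra.adjoin F s) V, Q.restrictScalars F = P := by
  have hmem : ∀ f ∈ Algebra.adjoin F s, ∀ v ∈ P, f v ∈ P := fun f hf => by
    induction hf using Algebra.adjoin_induction with
    | mem f hf => exact hP f hf
    | algebraMap r => exact fun v hv => P.smul_mem r hv
    | add f g _ _ hf hg => exact fun v hv => P.add_mem (hf v hv) (hg v hv)
    | mul _ g _ _ hf hg => exact fun v hv => hf (g v) (hg v hv)
  exact ⟨{ P.toAddSubmonoid with smul_mem' := fun f v => hmem f f.2 v }, rfl⟩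

end Generalities

section Image

variable {F B V : Type*} [CommRing F] [Ring B] [Algebra F B] [AddCommGroup V] [Module F V]
  [Module B V]

/-- The identity of `V`, semilinear over the corestriction of a representation `φ` of `B` on `V` to
its image; it transfers the submodule lattice between `B` and the image of `φ`. -/
def idToRange (φ : B →ₐ[F] Module.End F V) (hφ : ∀ b v, φ b v = b • v) :
    V →ₛₗ[φ.rangeRestrict.toRingHom] V :=
  { AddMonoidHom.id V with map_smul' := fun b v => (hφ b v).symm }

instance (φ : B →ₐ[F] Module.End F V) : RingHomSurjective φ.rangeRestrict.toRingHom :=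
  ⟨φ.rangeRestrict_surjective⟩

theorem isSemisimpleModule_range_iff (φ : B →ₐ[F] Module.End F V) (hφ : ∀ b v, φ b v = b • v) :
    IsSemisimpleModule φ.range V ↔ IsSemisimpleModule B V :=
  ((idToRange φ hφ).isSemisimpleModule_iff_of_bijective Function.bijective_id).symm

theorem isSimpleModule_range_iff (φ : B →ₐ[F] Module.End F V) (hφ : ∀ b v, φ b v = b • v) :
    IsSimpleModule φ.range V ↔ IsSimpleModule B V :=
  ((idToRange φ hφ).isSimpleModule_iff_of_bijective Function.bijective_id).symm

end Image

section EndomorphismAlgebra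

variable {F V : Type*} [Field F] [AddCommGroup V] [Module F V]

theorem isSemisimpleModule_adjoin_of_scalars {s : Set (Module.End F V)}
    (hs : ∀ f ∈ s, ∃ μ : F, f = μ • 1) : IsSemisimpleModule (Algebra.adjoin F s) V := by
  have hbot : Algebra.adjoin F s = (Algebra.ofId F (Module.End F V)).range := by
    refine le_antisymm (Algebra.adjoin_le fun f hf => ?_) ?_
    · obtain ⟨μ, rfl⟩ := hs f hf
      exact ⟨μ, Algebra.algebraMap_eq_smul_one μ⟩
    · rintro _ ⟨μ, rfl⟩
      exact Subalgebra.algebraMap_mem _ μ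
  rw [hbot, isSemisimpleModule_range_iff _ fun r v => rfl]
  infer_instance

theorem isDiagonalizable_of_span {f : Module.End F V}
    (h : ⊤ ≤ Submodule.span F {v : V | ∃ μ : F, f v = μ • v}) : IsDiagonalizable f :=
  ⟨_, Module.Basis.ofSpan h, fun i => Module.Basis.ofSpan_subset h ⟨i, rfl⟩⟩

theorem eq_smul_one_of_isDiagonalizable_of_isNilpotent {f : Module.End F V} {k : F}
    (hf : IsDiagonalizable f) (hn : IsNilpotent (f - k • 1)) : f = k • 1 := by
  obtain ⟨ι, b, hb⟩ := hf
  obtain ⟨n, hn⟩ := hn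
  refine b.ext fun i => ?_
  obtain ⟨μ, hμ⟩ := hb i
  have hpow : ((f - k • 1) ^ n) (b i) = (μ - k) ^ n • b i := by
    have : (f - k • 1).HasEigenvector (μ - k) (b i) :=
      ⟨Module.End.mem_eigenspace_iff.2 (by simp [hμ, sub_smul]), b.ne_zero i⟩
    exact this.pow_apply n
  rw [hn, LinearMap.zero_apply, eq_comm, smul_eq_zero_iff_left (b.ne_zero i)] at hpow
  rw [hμ, sub_eq_zero.1 (eq_zero_of_pow_eq_zero hpow)]
  rfl

open Polynomial in
theorem eigenspace_sup_eigenspace_eq_top {f : Module.End F V} {k k' : F} (hne : k ≠ k')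
    (hf : (f - k • 1) * (f - k' • 1) = 0) : f.eigenspace k ⊔ f.eigenspace k' = ⊤ := by
  have haeval : ∀ μ : F, aeval f (X - C μ) = f - μ • 1 := fun μ => by
    simp [Algebra.algebraMap_eq_smul_one]
  have := sup_ker_aeval_eq_ker_aeval_mul_of_coprime f
    (isCoprime_X_sub_C_of_isUnit_sub (sub_ne_zero.2 hne).isUnit)
  rwa [map_mul, haeval, haeval, hf, LinearMap.ker_zero, ← Module.End.eigenspace_def,
    ← Module.End.eigenspace_def] at this

theorem isDiagonalizable_of_eigenspace_sup_eq_top {f : Module.End F V} {k k' : F}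
    (h : f.eigenspace k ⊔ f.eigenspace k' = ⊤) : IsDiagonalizable f := by
  refine isDiagonalizable_of_span (h ▸ sup_le ?_ ?_) <;>
  exact fun v hv => Submodule.subset_span ⟨_, Module.End.mem_eigenspace_iff.1 hv⟩

end EndomorphismAlgebra

/-- Invertible elements `T 0, T 1, T 2, T 3` of an algebra subject to the relations of `H_q`, where
each central element `t_i + t_i⁻¹` has been specialized to the scalar `c i`. -/
structure IsDAHAQuadruple {F R : Type*} [Field F] [Ring R] [Algebra F R] (q : F) (c : Fin 4 → F)
    (T : Fin 4 → Rˣ) : Prop where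
  add_inv (i : Fin 4) : (T i : R) + (T i)⁻¹ = c i • 1
  prod : (T 0 * T 1 * T 2 * T 3 : R) = q⁻¹ • 1

/-- The element `T i * T 0 + (T i * T 0)⁻¹`. For `i = 1, 3, 2` it represents the generator
`A`, `B`, `C` of `△_q`; the index `i = 0`, for which it is a scalar, is allowed for uniformity. -/
def awElement {R : Type*} [Ring R] (T : Fin 4 → Rˣ) (i : Fin 4) : R :=
  ↑(T i * T 0) + ↑(T i * T 0)⁻¹

/-- The subalgebra generated by the elements `awElement T i`: the image of `△_q`. -/
abbrev awSubalgebra (F : Type*) {R : Type*} [CommSemiring F] [Ring R] [Algebra F R]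
    (T : Fin 4 → Rˣ) : Subalgebra F R :=
  Algebra.adjoin F (Set.range (awElement T))

/-- The permutation of the indices effected by `rotateQuadruple`. -/
def rotateIndex : Equiv.Perm (Fin 4) := c[1, 3, 2]

/-- The quadruple `T 0, (T 0)⁻¹ * T 3 * T 0, T 1, T 2`: it permutes the elements `awElement T i`
cyclically, which reduces statements about three indices to a statement about one of them. -/
def rotateQuadruple {G : Type*} [Group G] (T : Fin 4 → G) : Fin 4 → G :=
  ![T 0, (T 0)⁻¹ * T 3 * T 0, T 1, T 2]

namespace IsDAHAQuadruple

section Ring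

variable {F R : Type*} [Field F] [Ring R] [Algebra F R] {q : F} {c : Fin 4 → F} {T : Fin 4 → Rˣ}

theorem inv_eq (h : IsDAHAQuadruple q c T) (i : Fin 4) : (↑(T i)⁻¹ : R) = c i • 1 - T i :=
  eq_sub_of_add_eq' (h.add_inv i)

theorem mul_self (h : IsDAHAQuadruple q c T) (i : Fin 4) : (T i * T i : R) = c i • ↑(T i) - 1 := by
  rw [← (T i).mul_inv, h.inv_eq, mul_sub, mul_smul_comm, mul_one, sub_sub_cancel]

theorem sub_mul_sub_eq_zero (h : IsDAHAQuadruple q c T) {i : Fin 4} {k k' : F} (hkk : k * k' = 1)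
    (hc : c i = k + k') : (T i - k • 1 : R) * (T i - k' • 1) = 0 := by
  calc (T i - k • 1 : R) * (T i - k' • 1) = T i * T i - (k + k') • ↑(T i) + (k * k') • 1 := by
        simp only [mul_sub, sub_mul, mul_smul_comm, smul_mul_assoc, mul_one, one_mul]
        module
    _ = 0 := by rw [h.mul_self, hc, hkk, one_smul, sub_right_comm, sub_self, zero_sub,
        neg_add_cancel]

theorem commute_awElement (h : IsDAHAQuadruple q c T) (i : Fin 4) :
    Commute (T 0 : R) (awElement T i) := by
  have := AW.commute_aux (c 0) (c i) (T 0).mul_inv (T 0).inv_mul (h.inv_eq 0) (h.inv_eq i)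
  simpa only [Commute, SemiconjBy, awElement, mul_inv_rev, Units.val_mul] using this

theorem commute_of_mem_awSubalgebra (h : IsDAHAQuadruple q c T) {x : R}
    (hx : x ∈ awSubalgebra F T) : Commute (T 0 : R) x :=
  Algebra.commute_of_mem_adjoin_of_forall_mem_commute hx fun _ ⟨i, hi⟩ =>
    hi ▸ h.commute_awElement i

theorem t_zero_mul_add_mul_t_zero (h : IsDAHAQuadruple q c T) (i : Fin 4) :
    (T 0 * T i + T i * T 0 : R) =
      awElement T i - (c 0 * c i) • 1 + c 0 • ↑(T i) + c i • ↑(T 0) := by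
  rw [awElement, mul_inv_rev, Units.val_mul, Units.val_mul, h.inv_eq 0, h.inv_eq i]
  simp only [sub_mul, mul_sub, smul_mul_assoc, mul_smul_comm, one_mul, mul_one]
  module

theorem awElement_zero (h : IsDAHAQuadruple q c T) : awElement T 0 = (c 0 ^ 2 - 2) • (1 : R) := by
  rw [awElement, mul_inv_rev, Units.val_mul, Units.val_mul, h.inv_eq 0]
  simp only [sub_mul, mul_sub, smul_mul_assoc, mul_smul_comm, one_mul, mul_one, h.mul_self]
  module

theorem awElement_rotateQuadruple (h : IsDAHAQuadruple q c T) (i : Fin 4) :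
    awElement (rotateQuadruple T) i = awElement T (rotateIndex i) := by
  have hconj : awElement (rotateQuadruple T) 1 = ↑(T 0)⁻¹ * (awElement T 3 * T 0) := by
    simp [awElement, rotateQuadruple, mul_add, add_mul, mul_assoc]
  fin_cases i
  · rfl
  · change awElement (rotateQuadruple T) 1 = awElement T 3
    rw [hconj, ← (h.commute_awElement 3).eq, Units.inv_mul_cancel_left]
  · rfl
  · rfl

theorem rotate (h : IsDAHAQuadruple q c T) :
    IsDAHAQuadruple q (c ∘ rotateIndex) (rotateQuadruple T) where
  add_inv i := by
    fin_cases i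
    · exact h.add_inv 0
    · change (↑((T 0)⁻¹ * T 3 * T 0) + ↑((T 0)⁻¹ * T 3 * T 0)⁻¹ : R) = c 3 • 1
      calc _ = ↑(T 0)⁻¹ * ((T 3 : R) + ↑(T 3)⁻¹) * T 0 := by
            simp [mul_add, add_mul, mul_assoc]
        _ = c 3 • 1 := by rw [h.add_inv, mul_smul_comm, mul_one, smul_mul_assoc, Units.inv_mul]
    · exact h.add_inv 1
    · exact h.add_inv 2
  prod := by
    have hprod : (T 3 * T 0 * T 1 * T 2 : R) = q⁻¹ • 1 := by
      calc (T 3 * T 0 * T 1 * T 2 : R) = T 3 * (T 0 * T 1 * T 2 * T 3) * ↑(T 3)⁻¹ := by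
            simp [mul_assoc]
        _ = q⁻¹ • 1 := by rw [h.prod, mul_smul_comm, mul_one, smul_mul_assoc, Units.mul_inv]
    change (T 0 * ↑((T 0)⁻¹ * T 3 * T 0) * T 1 * T 2 : R) = q⁻¹ • 1
    simpa [mul_assoc] using hprod

theorem awSubalgebra_rotateQuadruple (h : IsDAHAQuadruple q c T) :
    awSubalgebra F (rotateQuadruple T) = awSubalgebra F T := by
  rw [awSubalgebra, funext h.awElement_rotateQuadruple, Set.range_comp' (awElement T),
    rotateIndex.range_eq_univ, Set.image_univ]

theorem awElement_relation (h : IsDAHAQuadruple q c T) (hq0 : q ≠ 0) :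
    (q ^ 2 - q⁻¹ ^ 2) • awElement T 1 + (q • (awElement T 3 * awElement T 2)
      - q⁻¹ • (awElement T 2 * awElement T 3))
      = (q - q⁻¹) • ((c 3 * c 2) • (1 : R) + c 1 • (q • (↑(T 0)⁻¹ : R) + q⁻¹ • (T 0 : R))) := by
  have := AW.relation_aux q q⁻¹ (c 0) (c 1) (c 2) (c 3) (mul_inv_cancel₀ hq0)
    (T 0).mul_inv (T 2).mul_inv (T 3).mul_inv (T 0).inv_mul (T 1).inv_mul (T 2).inv_mul
    (h.inv_eq 0) (h.inv_eq 1) (h.inv_eq 2) (h.inv_eq 3) h.prod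
  simpa only [awElement, mul_inv_rev, Units.val_mul] using this

theorem t_zero_mem_awSubalgebra_of_one_ne_zero (h : IsDAHAQuadruple q c T) (hq0 : q ≠ 0)
    (hq2 : q ^ 2 ≠ 1) (hc : c 1 ≠ 0) : (T 0 : R) ∈ awSubalgebra F T := by
  set 𝒜 := Subalgebra.toSubmodule (awSubalgebra F T)
  have hX (i : Fin 4) : awElement T i ∈ awSubalgebra F T := Algebra.subset_adjoin ⟨i, rfl⟩
  have hmul (i j : Fin 4) : awElement T i * awElement T j ∈ awSubalgebra F T :=
    mul_mem (hX i) (hX j)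
  have hq : q - q⁻¹ ≠ 0 := fun h0 => hq2 (by field_simp at h0; linear_combination h0)
  have hone (a : F) : a • (1 : R) ∈ 𝒜 := 𝒜.smul_mem a (one_mem (awSubalgebra F T))
  have hmem : (q - q⁻¹) • ((c 3 * c 2) • (1 : R) + c 1 • (q • (↑(T 0)⁻¹ : R) + q⁻¹ • (T 0 : R)))
      ∈ 𝒜 := by
    rw [← h.awElement_relation hq0]
    exact 𝒜.add_mem (𝒜.smul_mem _ (hX 1)) (𝒜.sub_mem
      (𝒜.smul_mem _ (hmul 3 2)) (𝒜.smul_mem _ (hmul 2 3)))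
  rw [𝒜.smul_mem_iff hq, 𝒜.add_mem_iff_right (hone _), 𝒜.smul_mem_iff hc, h.inv_eq] at hmem
  have hlin : q • (c 0 • (1 : R) - T 0) + q⁻¹ • (T 0 : R)
      = (q * c 0) • (1 : R) - (q - q⁻¹) • (T 0 : R) := by module
  rwa [hlin, 𝒜.sub_mem_iff_right (hone _), 𝒜.smul_mem_iff hq] at hmem

theorem t_zero_mem_awSubalgebra (h : IsDAHAQuadruple q c T) (hq0 : q ≠ 0) (hq2 : q ^ 2 ≠ 1)
    {i : Fin 4} (hi : i ≠ 0) (hc : c i ≠ 0) : (T 0 : R) ∈ awSubalgebra F T := by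
  fin_cases i
  · exact absurd rfl hi
  · exact h.t_zero_mem_awSubalgebra_of_one_ne_zero hq0 hq2 hc
  · rw [← h.awSubalgebra_rotateQuadruple, ← h.rotate.awSubalgebra_rotateQuadruple]
    exact h.rotate.rotate.t_zero_mem_awSubalgebra_of_one_ne_zero hq0 hq2 hc
  · rw [← h.awSubalgebra_rotateQuadruple]
    exact h.rotate.t_zero_mem_awSubalgebra_of_one_ne_zero hq0 hq2 hc

end Ring

end IsDAHAQuadruple

section Hull

variable {F V : Type*} [Field F] [AddCommGroup V] [Module F V] {q : F} {c : Fin 4 → F}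
  {T : Fin 4 → (Module.End F V)ˣ} {k k' : F} {W : Submodule F V}

/-- The sum of the subspaces `T i W`. For `W` inside an eigenspace of `T 0` and stable under the
elements `awElement T i` it is the `H_q`-submodule generated by `W`. -/
def dahaHull (T : Fin 4 → (Module.End F V)ˣ) (W : Submodule F V) : Submodule F V :=
  ⨆ i, W.map (T i : Module.End F V)

theorem smul_mem_dahaHull (i : Fin 4) {w : V} (hw : w ∈ W) : T i • w ∈ dahaHull T W :=
  Submodule.mem_iSup_of_mem i (Submodule.mem_map_of_mem hw)

theorem dahaHull_le_iff {P : Submodule F V} : dahaHull T W ≤ P ↔ ∀ i, ∀ w ∈ W, T i • w ∈ P := by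
  simp only [dahaHull, iSup_le_iff, Submodule.map_le_iff_le_comap]
  rfl

theorem le_dahaHull (hk : k ≠ 0) (hW : W ≤ Module.End.eigenspace (T 0).1 k) : W ≤ dahaHull T W :=
  fun w hw => by
    have := smul_mem_dahaHull (T := T) 0 hw
    rwa [Units.smul_def, Module.End.smul_def, Module.End.mem_eigenspace_iff.1 (hW hw),
      (dahaHull T W).smul_mem_iff hk] at this

namespace IsDAHAQuadruple

theorem inv_smul (h : IsDAHAQuadruple q c T) (i : Fin 4) (v : V) :
    (T i)⁻¹ • v = c i • v - T i • v := by
  rw [Units.smul_def, h.inv_eq, sub_smul]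
  rfl

theorem inv_smul_mem_iff (h : IsDAHAQuadruple q c T) (i : Fin 4) {P : Submodule F V} {v : V}
    (hv : v ∈ P) : (T i)⁻¹ • v ∈ P ↔ T i • v ∈ P := by
  rw [h.inv_smul, P.sub_mem_iff_right (P.smul_mem _ hv)]

theorem smul_smul_mem (h : IsDAHAQuadruple q c T) (i : Fin 4) {P : Submodule F V} {v : V}
    (hv : v ∈ P) (hTv : T i • v ∈ P) : T i • T i • v ∈ P := by
  rwa [← h.inv_smul_mem_iff i hTv, inv_smul_smul]

theorem t_zero_smul_t_one_smul (h : IsDAHAQuadruple q c T) (v : V) :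
    T 0 • T 1 • v = q⁻¹ • (T 3)⁻¹ • (T 2)⁻¹ • v := by
  have := LinearMap.congr_fun h.prod ((T 3)⁻¹ • (T 2)⁻¹ • v)
  change T 0 • T 1 • T 2 • T 3 • (T 3)⁻¹ • (T 2)⁻¹ • v = q⁻¹ • (T 3)⁻¹ • (T 2)⁻¹ • v at this
  rwa [smul_inv_smul, smul_inv_smul] at this

theorem t_zero_smul_t_smul (h : IsDAHAQuadruple q c T) (hc : c 0 = k + k') (i : Fin 4) {w : V}
    (hw : T 0 • w = k • w) :
    T 0 • T i • w = k' • T i • w + (awElement T i w - (k' * c i) • w) := by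
  have := LinearMap.congr_fun (h.t_zero_mul_add_mul_t_zero i) w
  change T 0 • T i • w + T i • T 0 • w = awElement T i w - (c 0 * c i) • w + c 0 • T i • w
    + c i • T 0 • w at this
  rw [hw, smul_comm (T i), ← eq_sub_iff_add_eq] at this
  rw [this, hc]
  generalize T i • w = u
  module

theorem t_zero_smul_t_smul_sub_mem (h : IsDAHAQuadruple q c T) (hc : c 0 = k + k')
    (hW : W ≤ Module.End.eigenspace (T 0).1 k) (hX : ∀ i, W ∈ (awElement T i).invtSubmodule)
    (i : Fin 4) {w : V} (hw : w ∈ W) : T 0 • T i • w - k' • T i • w ∈ W := by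
  rw [h.t_zero_smul_t_smul hc i (Module.End.mem_eigenspace_iff.1 (hW hw)), add_sub_cancel_left]
  exact W.sub_mem (hX i hw) (W.smul_mem _ hw)

theorem dahaHull_le_comap (h : IsDAHAQuadruple q c T) (hc : c 0 = k + k')
    (hW : W ≤ Module.End.eigenspace (T 0).1 k) (hX : ∀ i, W ∈ (awElement T i).invtSubmodule) :
    dahaHull T W ≤ W.comap ((T 0).1 - k' • 1) :=
  dahaHull_le_iff.2 fun i _ hw => h.t_zero_smul_t_smul_sub_mem hc hW hX i hw

theorem t_zero_smul_mem_dahaHull (h : IsDAHAQuadruple q c T) (hk : k ≠ 0) (hc : c 0 = k + k')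
    (hW : W ≤ Module.End.eigenspace (T 0).1 k) (hX : ∀ i, W ∈ (awElement T i).invtSubmodule)
    {v : V} (hv : v ∈ dahaHull T W) : T 0 • v ∈ dahaHull T W := by
  have : T 0 • v - k' • v ∈ dahaHull T W := le_dahaHull hk hW (h.dahaHull_le_comap hc hW hX hv)
  exact ((dahaHull T W).sub_mem_iff_left ((dahaHull T W).smul_mem k' hv)).1 this

theorem t_three_smul_mem_dahaHull (h : IsDAHAQuadruple q c T) (hq0 : q ≠ 0) (hkk : k * k' = 1)
    (hc : c 0 = k + k') (hW : W ≤ Module.End.eigenspace (T 0).1 k)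
    (hX : ∀ i, W ∈ (awElement T i).invtSubmodule) {v : V} (hv : v ∈ dahaHull T W) :
    T 3 • v ∈ dahaHull T W := by
  set M := dahaHull T W
  have hWM : W ≤ M := le_dahaHull (left_ne_zero_of_mul_eq_one hkk) hW
  have hTM (i : Fin 4) {w : V} (hw : w ∈ W) : T i • w ∈ M := smul_mem_dahaHull i hw
  have hinv {w : V} (hw : w ∈ W) : (T 2)⁻¹ • w ∈ M :=
    (h.inv_smul_mem_iff 2 (hWM hw)).2 (hTM 2 hw)
  suffices M ≤ M.comap (T 3).1 from this hv
  refine dahaHull_le_iff.2 fun i w hw => ?_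
  change T 3 • T i • w ∈ M
  fin_cases i
  · change T 3 • T 0 • w ∈ M
    have hw0 : T 0 • w = k • w := Module.End.mem_eigenspace_iff.1 (hW hw)
    rw [hw0, smul_comm]
    exact M.smul_mem k (hTM 3 hw)
  -- `T 3 * T 0 * T 1` is a multiple of `(T 2)⁻¹`, and `T 0` acts on `T 1 • w` as `k'` modulo `W`.
  · have h301 : T 3 • T 0 • T 1 • w ∈ M := by
      rw [h.t_zero_smul_t_one_smul, smul_comm (T 3), smul_inv_smul]
      exact M.smul_mem _ (hinv hw)
    have hy := hTM 3 (h.t_zero_smul_t_smul_sub_mem hc hW hX 1 hw)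
    rw [smul_sub, M.sub_mem_iff_right h301, smul_comm,
      M.smul_mem_iff (right_ne_zero_of_mul_eq_one hkk)] at hy
    exact hy
  -- `T 3` may be replaced by its inverse, and `(T 3)⁻¹ * (T 2)⁻¹` is a multiple of `T 0 * T 1`.
  · change T 3 • T 2 • w ∈ M
    have h32 : (T 3)⁻¹ • (T 2)⁻¹ • w ∈ M := by
      rw [← M.smul_mem_iff (inv_ne_zero hq0), ← h.t_zero_smul_t_one_smul]
      exact h.t_zero_smul_mem_dahaHull (left_ne_zero_of_mul_eq_one hkk) hc hW hX (hTM 1 hw)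
    rw [h.inv_smul_mem_iff 3 (hinv hw), h.inv_smul, smul_sub, smul_comm] at h32
    exact (M.sub_mem_iff_right (M.smul_mem _ (hTM 3 hw))).1 h32
  · exact h.smul_smul_mem 3 (hWM hw) (hTM 3 hw)

theorem invtSubmodule_awElement_rotateQuadruple (h : IsDAHAQuadruple q c T)
    (hX : ∀ i, W ∈ (awElement T i).invtSubmodule) (i : Fin 4) :
    W ∈ (awElement (rotateQuadruple T) i).invtSubmodule :=
  h.awElement_rotateQuadruple i ▸ hX _

theorem dahaHull_rotateQuadruple (h : IsDAHAQuadruple q c T) (hk : k ≠ 0) (hc : c 0 = k + k')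
    (hW : W ≤ Module.End.eigenspace (T 0).1 k) (hX : ∀ i, W ∈ (awElement T i).invtSubmodule) :
    dahaHull (rotateQuadruple T) W = dahaHull T W := by
  have hconj {w : V} (hw : w ∈ W) :
      ((T 0)⁻¹ * T 3 * T 0) • w = k • (T 0)⁻¹ • T 3 • w := by
    have hw0 : T 0 • w = k • w := Module.End.mem_eigenspace_iff.1 (hW hw)
    rw [mul_smul, mul_smul, hw0, smul_comm (T 3), smul_comm (T 0)⁻¹]
  refine le_antisymm (dahaHull_le_iff.2 fun i w hw => ?_) (dahaHull_le_iff.2 fun i w hw => ?_)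
  · fin_cases i
    · exact smul_mem_dahaHull 0 hw
    · change ((T 0)⁻¹ * T 3 * T 0) • w ∈ dahaHull T W
      have h3 : T 3 • w ∈ dahaHull T W := smul_mem_dahaHull 3 hw
      rw [hconj hw]
      exact Submodule.smul_mem _ _
        ((h.inv_smul_mem_iff 0 h3).2 (h.t_zero_smul_mem_dahaHull hk hc hW hX h3))
    · exact smul_mem_dahaHull 1 hw
    · exact smul_mem_dahaHull 2 hw
  · fin_cases i
    · exact smul_mem_dahaHull (T := rotateQuadruple T) 0 hw
    · exact smul_mem_dahaHull (T := rotateQuadruple T) 2 hw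
    · exact smul_mem_dahaHull (T := rotateQuadruple T) 3 hw
    · have h1 := smul_mem_dahaHull (T := rotateQuadruple T) 1 hw
      have h01 := h.rotate.t_zero_smul_mem_dahaHull hk hc hW
        (h.invtSubmodule_awElement_rotateQuadruple hX) h1
      change T 0 • ((T 0)⁻¹ * T 3 * T 0) • w ∈ _ at h01
      rwa [hconj hw, smul_comm (T 0), smul_inv_smul, Submodule.smul_mem_iff _ hk] at h01

theorem dahaHull_mem_invtSubmodule (h : IsDAHAQuadruple q c T) (hq0 : q ≠ 0) (hkk : k * k' = 1)
    (hc : c 0 = k + k') (hW : W ≤ Module.End.eigenspace (T 0).1 k)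
    (hX : ∀ i, W ∈ (awElement T i).invtSubmodule) (i : Fin 4) :
    dahaHull T W ∈ (T i).1.invtSubmodule := by
  have hk := left_ne_zero_of_mul_eq_one hkk
  have h' := h.rotate
  have hX' := h.invtSubmodule_awElement_rotateQuadruple hX
  have hX'' := h'.invtSubmodule_awElement_rotateQuadruple hX'
  have hull' := h.dahaHull_rotateQuadruple hk hc hW hX
  have hull'' := (h'.dahaHull_rotateQuadruple hk hc hW hX').trans hull'
  fin_cases i <;> intro v hv
  · exact h.t_zero_smul_mem_dahaHull hk hc hW hX hv
  · rw [← hull''] at hv ⊢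
    exact h'.rotate.t_three_smul_mem_dahaHull hq0 hkk hc hW hX'' hv
  · rw [← hull'] at hv ⊢
    exact h'.t_three_smul_mem_dahaHull hq0 hkk hc hW hX' hv
  · exact h.t_three_smul_mem_dahaHull hq0 hkk hc hW hX hv

end IsDAHAQuadruple

end Hull

section Eigenspaces

variable {F V : Type*} [Field F] [AddCommGroup V] [Module F V] {q : F} {c : Fin 4 → F}
  {T : Fin 4 → (Module.End F V)ˣ} {k k' : F}

namespace IsDAHAQuadruple

theorem eq_bot_or_eq_eigenspace (h : IsDAHAQuadruple q c T) (hq0 : q ≠ 0)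
    [IsSimpleModule (Algebra.adjoin F (Set.range fun i => (T i).1)) V] (hkk : k * k' = 1)
    (hc : c 0 = k + k') (hne : k ≠ k') {W : Submodule F V}
    (hW : W ≤ Module.End.eigenspace (T 0).1 k) (hX : ∀ i, W ∈ (awElement T i).invtSubmodule) :
    W = ⊥ ∨ W = Module.End.eigenspace (T 0).1 k := by
  obtain ⟨M, hM⟩ := exists_restrictScalars_eq (s := Set.range fun i => (T i).1) (P := dahaHull T W)
    (by rintro _ ⟨i, rfl⟩; exact h.dahaHull_mem_invtSubmodule hq0 hkk hc hW hX i)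
  rcases eq_bot_or_eq_top M with rfl | rfl
  · left
    refine eq_bot_iff.2 ((le_dahaHull (left_ne_zero_of_mul_eq_one hkk) hW).trans_eq ?_)
    exact hM.symm.trans (Submodule.restrictScalars_bot F _ V)
  · right
    refine le_antisymm hW fun v hv => ?_
    have hvW : T 0 • v - k' • v ∈ W :=
      h.dahaHull_le_comap hc hW hX (hM ▸ Submodule.mem_top (R := F) (x := v))
    have hv0 : T 0 • v = k • v := Module.End.mem_eigenspace_iff.1 hv
    rwa [hv0, ← sub_smul, W.smul_mem_iff (sub_ne_zero.2 hne)] at hvW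

theorem isSemisimpleModule_of_restrictScalars_eq_eigenspace (h : IsDAHAQuadruple q c T)
    (hq0 : q ≠ 0) [IsSimpleModule (Algebra.adjoin F (Set.range fun i => (T i).1)) V]
    (hkk : k * k' = 1) (hc : c 0 = k + k') (hne : k ≠ k') {E : Submodule (awSubalgebra F T) V}
    (hE : E.restrictScalars F = Module.End.eigenspace (T 0).1 k) :
    IsSemisimpleModule (awSubalgebra F T) E := by
  refine isSemisimpleModule_of_forall_le fun W hW => ?_
  have hX (i : Fin 4) : W.restrictScalars F ∈ (awElement T i).invtSubmodule :=
    fun v hv => W.smul_mem ⟨_, Algebra.subset_adjoin ⟨i, rfl⟩⟩ hv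
  have hW' := h.eq_bot_or_eq_eigenspace hq0 hkk hc hne (hE ▸ hW) hX
  rwa [← hE, Submodule.restrictScalars_eq_bot_iff,
    (Submodule.restrictScalars_injective F _ V).eq_iff] at hW'

theorem isSemisimpleModule_awSubalgebra_of_ne (h : IsDAHAQuadruple q c T) (hq0 : q ≠ 0)
    [IsSimpleModule (Algebra.adjoin F (Set.range fun i => (T i).1)) V] (hkk : k * k' = 1)
    (hc : c 0 = k + k') (hne : k ≠ k') : IsSemisimpleModule (awSubalgebra F T) V := by
  have heigen (μ : F) : ∃ E : Submodule (awSubalgebra F T) V,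
      E.restrictScalars F = Module.End.eigenspace (T 0).1 μ := by
    refine exists_restrictScalars_eq ?_
    rintro _ ⟨i, rfl⟩
    exact Module.End.mapsTo_genEigenspace_of_comm (h.commute_awElement i) μ 1
  obtain ⟨E, hE⟩ := heigen k
  obtain ⟨E', hE'⟩ := heigen k'
  have hss := h.isSemisimpleModule_of_restrictScalars_eq_eigenspace hq0 hkk hc hne hE
  have hss' := h.isSemisimpleModule_of_restrictScalars_eq_eigenspace hq0
    ((mul_comm k' k).trans hkk) (hc.trans (add_comm k k')) hne.symm hE'
  refine isSemisimpleModule_of_sup_eq_top (P := E) (Q := E') (eq_top_iff.2 fun v _ => ?_)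
  have hv : v ∈ E.restrictScalars F ⊔ E'.restrictScalars F := by
    rw [hE, hE', eigenspace_sup_eigenspace_eq_top hne (h.sub_mul_sub_eq_zero hkk hc)]
    trivial
  obtain ⟨x, hx, y, hy, rfl⟩ := Submodule.mem_sup.1 hv
  exact Submodule.add_mem_sup hx hy

theorem isDiagonalizable_of_ne (h : IsDAHAQuadruple q c T) (hkk : k * k' = 1)
    (hc : c 0 = k + k') (hne : k ≠ k') : IsDiagonalizable (T 0).1 :=
  isDiagonalizable_of_eigenspace_sup_eq_top
    (eigenspace_sup_eigenspace_eq_top hne (h.sub_mul_sub_eq_zero hkk hc))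

end IsDAHAQuadruple

end Eigenspaces

section DoubleRoot

namespace IsDAHAQuadruple

theorem isNilpotent_t_zero_sub {F R : Type*} [Field F] [Ring R] [Algebra F R] {q : F}
    {c : Fin 4 → F} {T : Fin 4 → Rˣ} {k : F} (h : IsDAHAQuadruple q c T) (hkk : k * k = 1)
    (hc : c 0 = k + k) :
    IsNilpotent (T 0 - k • 1 : R) :=
  ⟨2, by rw [sq, h.sub_mul_sub_eq_zero hkk hc]⟩

theorem awElement_eq_smul_one {F R : Type*} [Field F] [Ring R] [Algebra F R] {q : F}
    {c : Fin 4 → F} {T : Fin 4 → Rˣ} {k : F} (h : IsDAHAQuadruple q c T)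
    (hc : c 0 = k + k) (hT : (T 0 : R) = k • 1) (i : Fin 4) :
    awElement T i = (k * c i) • (1 : R) := by
  rw [awElement, mul_inv_rev, Units.val_mul, Units.val_mul, h.inv_eq 0, h.inv_eq i, hT, hc]
  simp only [sub_mul, mul_sub, smul_mul_assoc, mul_smul_comm, one_mul, mul_one]
  module

variable {F V : Type*} [Field F] [AddCommGroup V] [Module F V] {q : F} {c : Fin 4 → F}
  {T : Fin 4 → (Module.End F V)ˣ} {k : F}

theorem det_pow_four_of_eq_zero (h : IsDAHAQuadruple q c T) {i : Fin 4} (hc : c i = 0) :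
    LinearMap.det (T i).1 ^ 4 = 1 := by
  have hsq : (T i).1 * (T i).1 = (-1 : F) • 1 := by rw [h.mul_self, hc]; module
  calc LinearMap.det (T i).1 ^ 4 = LinearMap.det ((T i).1 * (T i).1) ^ 2 := by
        rw [map_mul]; ring
    _ = ((-1) ^ Module.finrank F V) ^ 2 := by rw [hsq, LinearMap.det_smul, map_one, mul_one]
    _ = 1 := by rw [← pow_mul, mul_comm, pow_mul, neg_one_sq, one_pow]

theorem det_t_zero_pow_four [FiniteDimensional F V] (h : IsDAHAQuadruple q c T) (hkk : k * k = 1)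
    (hc : c 0 = k + k) : LinearMap.det (T 0).1 ^ 4 = 1 := by
  have hdet := LinearMap.eval_charpoly (k • 1 - (T 0).1) k
  have hnil : IsNilpotent (k • 1 - (T 0).1) :=
    neg_sub (T 0).1 _ ▸ (h.isNilpotent_t_zero_sub hkk hc).neg
  rw [hnil.charpoly_eq_X_pow_finrank, Algebra.algebraMap_eq_smul_one, sub_sub_cancel,
    Polynomial.eval_pow, Polynomial.eval_X] at hdet
  rw [← hdet, ← pow_mul, mul_comm, pow_mul, show k ^ 4 = (k * k) ^ 2 by ring, hkk, one_pow, one_pow]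

theorem pow_four_mul_finrank_eq_one [FiniteDimensional F V] (h : IsDAHAQuadruple q c T)
    (hkk : k * k = 1) (hc₀ : c 0 = k + k) (hc : ∀ i ≠ 0, c i = 0) :
    q ^ (4 * Module.finrank F V) = 1 := by
  have hdet := congrArg (fun f => LinearMap.det f ^ 4) h.prod
  simp only [map_mul, mul_pow, LinearMap.det_smul, map_one, mul_one, h.det_t_zero_pow_four hkk hc₀,
    h.det_pow_four_of_eq_zero (hc 1 (by decide)), h.det_pow_four_of_eq_zero (hc 2 (by decide)),
    h.det_pow_four_of_eq_zero (hc 3 (by decide))] at hdet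
  rwa [← pow_mul, inv_pow, eq_comm, inv_eq_one, mul_comm] at hdet

theorem t_zero_eq_smul_one_of_isSemisimpleModule [FiniteDimensional F V] [Nontrivial V]
    (h : IsDAHAQuadruple q c T) (hq0 : q ≠ 0) (hq : ∀ n : ℕ, 0 < n → q ^ n ≠ 1) (hkk : k * k = 1)
    (hc : c 0 = k + k) [IsSemisimpleModule (awSubalgebra F T) V] : (T 0).1 = k • 1 := by
  obtain ⟨i, hi, hci⟩ : ∃ i ≠ 0, c i ≠ 0 := by
    by_contra! hzero
    exact hq _ (Nat.mul_pos four_pos Module.finrank_pos)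
      (h.pow_four_mul_finrank_eq_one hkk hc hzero)
  have hT : (T 0).1 ∈ awSubalgebra F T := h.t_zero_mem_awSubalgebra hq0 (hq 2 two_pos) hi hci
  have hmem : (T 0).1 - k • 1 ∈ awSubalgebra F T :=
    sub_mem hT ((awSubalgebra F T).smul_mem (one_mem _) k)
  have hnil : IsNilpotent (⟨(T 0).1 - k • 1, hmem⟩ : awSubalgebra F T) :=
    (IsNilpotent.map_iff (f := (awSubalgebra F T).val) Subtype.val_injective).1
      (h.isNilpotent_t_zero_sub hkk hc)
  have hcomm (b : awSubalgebra F T) : Commute b ⟨(T 0).1 - k • 1, hmem⟩ := by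
    refine Subtype.ext ?_
    exact ((h.commute_of_mem_awSubalgebra b.2).symm.sub_right
      ((Commute.one_right _).smul_right k)).eq
  refine LinearMap.ext fun v => sub_eq_zero.1 ?_
  exact smul_eq_zero_of_isNilpotent_of_commute hnil hcomm v

theorem isSemisimpleModule_awSubalgebra_of_eq_smul_one (h : IsDAHAQuadruple q c T)
    (hc : c 0 = k + k) (hT : (T 0).1 = k • 1) : IsSemisimpleModule (awSubalgebra F T) V :=
  isSemisimpleModule_adjoin_of_scalars fun _ ⟨i, hi⟩ =>
    ⟨_, hi ▸ h.awElement_eq_smul_one hc hT i⟩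

theorem isSemisimpleModule_awSubalgebra_iff_isDiagonalizable [IsAlgClosed F] [FiniteDimensional F V]
    (h : IsDAHAQuadruple q c T) (hq0 : q ≠ 0) (hq : ∀ n : ℕ, 0 < n → q ^ n ≠ 1)
    [IsSimpleModule (Algebra.adjoin F (Set.range fun i => (T i).1)) V] :
    IsSemisimpleModule (awSubalgebra F T) V ↔ IsDiagonalizable (T 0).1 := by
  obtain ⟨k, k', hkk, hc⟩ := exists_mul_eq_one_and_eq_add (c 0)
  rcases ne_or_eq k k' with hne | rfl
  · exact iff_of_true (h.isSemisimpleModule_awSubalgebra_of_ne hq0 hkk hc hne)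
      (h.isDiagonalizable_of_ne hkk hc hne)
  have : Nontrivial V :=
    IsSimpleModule.nontrivial (Algebra.adjoin F (Set.range fun i => (T i).1)) V
  constructor
  · intro _
    have hT := h.t_zero_eq_smul_one_of_isSemisimpleModule hq0 hq hkk hc
    exact isDiagonalizable_of_span fun v _ => Submodule.subset_span ⟨k, by rw [hT]; rfl⟩
  · intro hdiag
    exact h.isSemisimpleModule_awSubalgebra_of_eq_smul_one hc
      (eq_smul_one_of_isDiagonalizable_of_isNilpotent hdiag (h.isNilpotent_t_zero_sub hkk hc))

end IsDAHAQuadruple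

end DoubleRoot

section Representation

namespace UniversalDAHA

variable {F : Type*} [Field F] {q : F} {V : Type*} [AddCommGroup V] [Module F V]
  [Module (UniversalDAHA q) V] [IsScalarTower F (UniversalDAHA q) V] {c : Fin 4 → F}

variable (q V) in
/-- The action of the generator `t_i` on an `H_q`-module, as a unit of the endomorphism algebra. -/
def tEnd (i : Fin 4) : (Module.End F V)ˣ :=
  Units.map (Algebra.lsmul F F V : UniversalDAHA q →ₐ[F] Module.End F V)
    ⟨t q i, tInv q i, t_mul_tInv q i, tInv_mul_t q i⟩

theorem exists_isDAHAQuadruple_tEnd [IsAlgClosed F] [FiniteDimensional F V]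
    [IsSimpleModule (UniversalDAHA q) V] : ∃ c, IsDAHAQuadruple q c (tEnd q V) := by
  choose c hc using fun i =>
    exists_smul_eq_of_forall_commute (F := F) (V := V) (central q i)
  refine ⟨c, fun i => LinearMap.ext fun v => ?_, LinearMap.ext fun v => ?_⟩
  · exact (add_smul _ _ v).symm.trans (hc i v)
  · calc t q 0 • t q 1 • t q 2 • t q 3 • v = (t q 0 * t q 1 * t q 2 * t q 3) • v := by
          simp only [mul_smul]
      _ = q⁻¹ • v := by rw [prod_t, algebraMap_smul]

theorem range_lsmul_eq_adjoin (h : IsDAHAQuadruple q c (tEnd q V)) :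
    (Algebra.lsmul F F V : UniversalDAHA q →ₐ[F] Module.End F V).range =
      Algebra.adjoin F (Set.range fun i => (tEnd q V i).1) := by
  refine le_antisymm ?_ (Algebra.adjoin_le ?_)
  · rw [range_eq_adjoin_mkAlgHom_ι]
    refine Algebra.adjoin_le ?_
    have hT (i : Fin 4) : (tEnd q V i).1 ∈
        Algebra.adjoin F (Set.range fun i => (tEnd q V i).1) := Algebra.subset_adjoin ⟨i, rfl⟩
    rintro _ ⟨i | i, rfl⟩
    · exact hT i
    · change (↑(tEnd q V i)⁻¹ : Module.End F V) ∈ Algebra.adjoin F _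
      rw [h.inv_eq]
      exact sub_mem (Subalgebra.smul_mem _ (one_mem _) _) (hT i)
  · rintro _ ⟨i, rfl⟩
    exact ⟨t q i, rfl⟩

theorem isSimpleModule_adjoin_tEnd [IsSimpleModule (UniversalDAHA q) V]
    (h : IsDAHAQuadruple q c (tEnd q V)) :
    IsSimpleModule (Algebra.adjoin F (Set.range fun i => (tEnd q V i).1)) V := by
  rw [← range_lsmul_eq_adjoin h]
  exact (isSimpleModule_range_iff _ fun _ _ => rfl).2 ‹_›

theorem range_lsmul_comp_zeta (h : IsDAHAQuadruple q c (tEnd q V)) (hq0 : q ≠ 0)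
    (hq : ∀ n : ℕ, 0 < n → q ^ n ≠ 1) :
    ((Algebra.lsmul F F V).comp (zeta q hq0 hq)).range = awSubalgebra F (tEnd q V) := by
  have hA : Algebra.lsmul F F V (zeta q hq0 hq (UniversalAW.gen q .A)) =
      awElement (tEnd q V) 1 := by
    simp [zeta_gen, zetaGen, awElement, tEnd]
  have hB : Algebra.lsmul F F V (zeta q hq0 hq (UniversalAW.gen q .B)) =
      awElement (tEnd q V) 3 := by
    simp [zeta_gen, zetaGen, awElement, tEnd]
  have hC : Algebra.lsmul F F V (zeta q hq0 hq (UniversalAW.gen q .C)) =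
      awElement (tEnd q V) 2 := by
    simp [zeta_gen, zetaGen, awElement, tEnd]
  rw [range_eq_adjoin_mkAlgHom_ι]
  refine le_antisymm (Algebra.adjoin_le ?_) (Algebra.adjoin_le ?_)
  · rintro _ ⟨_ | _ | _, rfl⟩
    · exact Algebra.subset_adjoin ⟨1, hA.symm⟩
    · exact Algebra.subset_adjoin ⟨3, hB.symm⟩
    · exact Algebra.subset_adjoin ⟨2, hC.symm⟩
  · rintro _ ⟨i, rfl⟩
    fin_cases i
    · exact h.awElement_zero ▸ Subalgebra.smul_mem _ (one_mem _) _
    · exact Algebra.subset_adjoin ⟨.A, hA⟩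
    · exact Algebra.subset_adjoin ⟨.C, hC⟩
    · exact Algebra.subset_adjoin ⟨.B, hB⟩

theorem isSemisimpleModule_pullbackModule_iff (h : IsDAHAQuadruple q c (tEnd q V)) (hq0 : q ≠ 0)
    (hq : ∀ n : ℕ, 0 < n → q ^ n ≠ 1) :
    (letI : Module (UniversalAW q) V := pullbackModule q hq0 hq V;
      IsSemisimpleModule (UniversalAW q) V) ↔ IsSemisimpleModule (awSubalgebra F (tEnd q V)) V := by
  let : Module (UniversalAW q) V := pullbackModule q hq0 hq V
  rw [← range_lsmul_comp_zeta h hq0 hq]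
  exact (isSemisimpleModule_range_iff _ fun _ _ => rfl).symm

end UniversalDAHA

end Representation

theorem mainTheorem2 {F : Type*} [Field F] [IsAlgClosed F] (q : F) (hq0 : q ≠ 0)
    (hq : ∀ n : ℕ, 0 < n → q ^ n ≠ 1)
    (V : Type*) [AddCommGroup V] [Module F V] [Module (UniversalDAHA q) V]
    [IsScalarTower F (UniversalDAHA q) V] [FiniteDimensional F V]
    [IsSimpleModule (UniversalDAHA q) V] :
    (letI : Module (UniversalAW q) V := UniversalDAHA.pullbackModule q hq0 hq V;
      IsSemisimpleModule (UniversalAW q) V) ↔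
      IsDiagonalizable (Algebra.lsmul F F V (UniversalDAHA.t q 0)) := by
  obtain ⟨c, h⟩ := UniversalDAHA.exists_isDAHAQuadruple_tEnd (q := q) (V := V)
  have := UniversalDAHA.isSimpleModule_adjoin_tEnd h
  rw [UniversalDAHA.isSemisimpleModule_pullbackModule_iff h hq0 hq]
  exact h.isSemisimpleModule_awSubalgebra_iff_isDiagonalizable hq0 hq
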